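/- A $(k,g)$-graph is a finite simple $k$-regular graph of girth $g$. For even $g=2d$ the Moore bound is $M(k,g)=2\left(1+(k-1)+\dots+(k-1)^{d-1}\right)$, and the excess of a $(k,g)$-graph with $n$ vertices is $n-M(k,g)$. The excess graph $G(E)$ of a $(k,2d)$-graph $G$ of excess $4$ is the graph on the vertex set of $G$ in which two vertices are adjacent if and only if their distance in $G$ is $d+1$. Theorem. Let $k\ge 7$ be odd, let $g=2d\ge 8$, and let $G$ be a $(k,g)$-graph of excess $4$. Then $G(E)$ is a disjoint union of cycles. Moreover, let $c$ be the number of cycles of $G(E)$ and let $c_2$ be the number of those of even length. 1) If $d$ is odd, then $d-1$ divides both $c-2$ and $c_2$. 2) If $d$ is even, then $d-1$ divides both $c-1$ and $c_2-1$. -/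

import Mathlib

namespace CageExcess

/-- A `(k, g)`-graph: a finite simple graph that is `k`-regular and has girth `g`. -/
structure IsKGGraph {V : Type*} [Fintype V] (G : SimpleGraph V) [DecidableRel G.Adj]
    (k g : ℕ) : Prop where
  regular : G.IsRegularOfDegree k
  girth_eq : G.girth = g

/-- The Moore bound `M(k, g)`:
`1 + k + k(k-1) + ... + k(k-1)^((g-3)/2)` for odd `g`, and
`2 (1 + (k-1) + ... + (k-1)^((g-2)/2))` for even `g`. -/
def mooreBound (k g : ℕ) : ℤ :=
  if Odd g then 1 + ∑ i ∈ Finset.range ((g - 1) / 2), (k : ℤ) * ((k : ℤ) - 1) ^ i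
  else 2 * ∑ i ∈ Finset.range (g / 2), ((k : ℤ) - 1) ^ i

/-- The excess of a `(k, g)`-graph on the vertex set `V`: its order minus the Moore bound. -/
def excess (V : Type*) [Fintype V] (k g : ℕ) : ℤ :=
  (Fintype.card V : ℤ) - mooreBound k g

/-- The excess graph `G(E)` of a graph `G` of girth `2d`: it has the same vertices as `G`, and
two vertices are adjacent exactly when they are at distance `d + 1` in `G`. (`SimpleGraph.dist`
is `0` on pairs of vertices that are not connected, so such pairs are never adjacent here.) -/
def excessGraph {V : Type*} (G : SimpleGraph V) (d : ℕ) : SimpleGraph V where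
  Adj u v := G.dist u v = d + 1
  symm := ⟨fun u v h => by rw [SimpleGraph.dist_comm]; exact h⟩
  loopless := ⟨fun u h => by simp at h⟩

/-- The connected component `C` of `H` is a cycle of length `l` (with `l ≥ 3`). -/
def IsCycleOfLength {V : Type*} {H : SimpleGraph V} (C : H.ConnectedComponent) (l : ℕ) : Prop :=
  3 ≤ l ∧ Nonempty (C.toSimpleGraph ≃g SimpleGraph.cycleGraph l)

/-- `H` is a disjoint union of cycles: every connected component of `H` is a cycle. -/
def IsDisjointUnionOfCycles {V : Type*} (H : SimpleGraph V) : Prop :=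
  ∀ C : H.ConnectedComponent, ∃ l : ℕ, IsCycleOfLength C l

/-- The number of components of `H` that are cycles; for a disjoint union of cycles this is the
number `c` of its cycles. -/
noncomputable def numCycles {V : Type*} (H : SimpleGraph V) : ℕ :=
  {C : H.ConnectedComponent | ∃ l : ℕ, IsCycleOfLength C l}.ncard

/-- The number of components of `H` that are cycles of even length; for a disjoint union of
cycles this is the number `c₂` of its even cycles. -/
noncomputable def numEvenCycles {V : Type*} (H : SimpleGraph V) : ℕ :=
  {C : H.ConnectedComponent | ∃ l : ℕ, Even l ∧ IsCycleOfLength C l}.ncard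

end CageExcess

/-!
Let `A` be the adjacency matrix of `G`, put `q = k - 1`, and let `Pₙ` be the Dickson polynomial
`dickson 2 q n`. For `n < d` the entries of `Pₙ(A)` are the indicator function of the distances
`n`, `n - 2`, …. Since the excess is less than `k - 1`, the graph is bipartite of diameter at most
`d + 1`, and the distances of the parity of `d - 1` other than `d + 1` are exactly those seen by
`P_{d-1}(A)`. Hence twice the adjacency matrix of `G(E)` is `J ± s sᵀ - 2 P_{d-1}(A)`, where `J` is
the all-ones matrix and `s` is the vector with entries `±1` given by the two-colouring. Applied to
the vector `1` this shows that `G(E)` is `2`-regular, so a disjoint union of cycles.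

The eigenspaces of `G(E)` for the eigenvalues `2` and `-2` have dimensions `c` and `c₂`. Inside the
orthogonal complement of `1` and `s`, the eigenspace for `±2` is the kernel of `P_{d-1}(A) ± 2`.
As `q` is even, the polynomial `P_{d-1} ± 2` is Eisenstein at `2`, so it is irreducible over `ℚ` of
degree `d - 1`, and `d - 1` divides the dimension of this kernel. The summands `1` and `2` in the
theorem account for `1` and `s`, which are eigenvectors of `G(E)` for `2` and `2 (-1)^(d-1)`.
-/

namespace CageExcess

open Finset Matrix Polynomial

section Girth

variable {V : Type*} {G : SimpleGraph V} {d : ℕ} {x y a b : V}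

lemma eq_of_isPath_of_length_add_lt_egirth {p q : G.Walk x y} (hp : p.IsPath) (hq : q.IsPath)
    (h : ((p.length + q.length : ℕ) : ℕ∞) < G.egirth) : p = q := by
  by_contra hne
  obtain ⟨w, -, -, c, hc, hl⟩ := hp.exists_isCycle_length_le_add_of_ne hq hne
  exact (h.trans_le (SimpleGraph.egirth_le_length hc)).not_ge (mod_cast hl)

lemma not_adj_of_common_neighbor (hg : 3 < G.egirth) (ha : G.Adj y a) (hb : G.Adj y b) :
    ¬ G.Adj a b := by
  intro hab
  have h := eq_of_isPath_of_length_add_lt_egirth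
    (p := .cons ha (.cons hab .nil)) (q := .cons hb .nil)
    (by simp [ha.ne, hb.ne, hab.ne]) (by simp [hb.ne]) (by simpa using hg)
  simpa using congrArg SimpleGraph.Walk.length h

lemma eq_of_two_common_neighbors (hg : 4 < G.egirth) (hab : a ≠ b) (hax : G.Adj a x)
    (hbx : G.Adj b x) (hay : G.Adj a y) (hby : G.Adj b y) : x = y := by
  have h := eq_of_isPath_of_length_add_lt_egirth
    (p := .cons hax (.cons hbx.symm .nil)) (q := .cons hay (.cons hby.symm .nil))
    (by simp [hax.ne, hbx.ne', hab]) (by simp [hay.ne, hby.ne', hab]) (by simpa using hg)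
  simpa using congrArg SimpleGraph.Walk.snd h

lemma dist_le_dist_add_one_of_adj (hab : G.Adj a b) : G.dist x b ≤ G.dist x a + 1 := by
  rcases hab.diff_dist_adj (u := x) with h | h | h <;> omega

lemma exists_adj_dist_add_one_eq (h : G.dist x y ≠ 0) :
    ∃ w, G.Adj y w ∧ G.dist x w + 1 = G.dist x y := by
  obtain ⟨p, hp⟩ := (SimpleGraph.Reachable.of_dist_ne_zero h).exists_walk_length_eq_dist
  have hnil : ¬ p.Nil := fun hn => h (hp ▸ SimpleGraph.Walk.length_eq_zero_iff.2 hn)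
  have hadj := p.adj_penultimate hnil
  refine ⟨p.penultimate, hadj.symm, le_antisymm ?_ (dist_le_dist_add_one_of_adj hadj)⟩
  have := SimpleGraph.dist_le p.dropLast
  have := p.length_dropLast_add_one hnil
  omega

lemma eq_of_adj_of_dist_add_one_eq (hg : ((2 * d : ℕ) : ℕ∞) ≤ G.egirth) (hy : G.dist x y < d)
    (ha : G.Adj y a) (hb : G.Adj y b) (hxa : G.dist x a + 1 = G.dist x y)
    (hxb : G.dist x b + 1 = G.dist x y) : a = b := by
  have hxy : G.Reachable y x :=
    (SimpleGraph.Reachable.of_dist_ne_zero (u := x) (by omega)).symm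
  obtain ⟨p, hp⟩ := (ha.symm.reachable.trans hxy).exists_walk_length_eq_dist
  obtain ⟨q, hq⟩ := (hb.symm.reachable.trans hxy).exists_walk_length_eq_dist
  rw [SimpleGraph.dist_comm] at hp hq
  have hap : (SimpleGraph.Walk.cons ha p).IsPath := SimpleGraph.Walk.isPath_of_length_eq_dist _
    (by rw [SimpleGraph.Walk.length_cons, SimpleGraph.dist_comm, hp, hxa])
  have hbq : (SimpleGraph.Walk.cons hb q).IsPath := SimpleGraph.Walk.isPath_of_length_eq_dist _
    (by rw [SimpleGraph.Walk.length_cons, SimpleGraph.dist_comm, hq, hxb])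
  have h := eq_of_isPath_of_length_add_lt_egirth hap hbq <| lt_of_lt_of_le
    (by simp only [SimpleGraph.Walk.length_cons]; exact_mod_cast (by omega)) hg
  simpa using congrArg SimpleGraph.Walk.snd h

lemma dist_ne_dist_of_adj_of_dist_lt (hg : ((2 * d : ℕ) : ℕ∞) ≤ G.egirth)
    (hxa : G.Reachable x a) (h : G.dist x a < d) (hab : G.Adj a b) :
    G.dist x a ≠ G.dist x b := by
  classical
  intro he
  obtain ⟨p, hp⟩ := hxa.symm.exists_walk_length_eq_dist
  obtain ⟨q, hq⟩ := (hxa.trans hab.reachable).symm.exists_walk_length_eq_dist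
  have hpp := p.isPath_of_length_eq_dist hp
  have hqp := q.isPath_of_length_eq_dist hq
  have haq : a ∉ q.support := fun ha => by
    have hsplit := congrArg SimpleGraph.Walk.length (q.take_spec ha)
    rw [SimpleGraph.Walk.length_append] at hsplit
    have hdrop := SimpleGraph.dist_le (q.dropUntil a ha)
    rw [SimpleGraph.dist_comm] at hdrop hq
    exact hab.ne' (SimpleGraph.Walk.eq_of_length_eq_zero (p := q.takeUntil a ha) (by omega))
  rw [SimpleGraph.dist_comm] at hp hq
  have hcons := eq_of_isPath_of_length_add_lt_egirth hpp (hqp.cons (h := hab) haq) <| lt_of_lt_of_le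
    (by simp only [SimpleGraph.Walk.length_cons]; exact_mod_cast (by omega)) hg
  have := congrArg SimpleGraph.Walk.length hcons
  rw [SimpleGraph.Walk.length_cons] at this
  omega

end Girth

section Neighbors

variable {V : Type*} [Fintype V] {G : SimpleGraph V} [DecidableRel G.Adj] {d q : ℕ} {x y : V}

/-- The neighbours of `y` that are one step closer to `x` than `y`. -/
noncomputable def closerNeighbors (G : SimpleGraph V) [DecidableRel G.Adj] (x y : V) : Finset V :=
  {w ∈ G.neighborFinset y | G.dist x w + 1 = G.dist x y}

/-- The neighbours of `y` that are one step farther from `x` than `y`. -/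
noncomputable def fartherNeighbors (G : SimpleGraph V) [DecidableRel G.Adj] (x y : V) : Finset V :=
  {w ∈ G.neighborFinset y | G.dist x w = G.dist x y + 1}

lemma mem_closerNeighbors {w : V} :
    w ∈ closerNeighbors G x y ↔ G.Adj y w ∧ G.dist x w + 1 = G.dist x y := by
  simp only [closerNeighbors, mem_filter, SimpleGraph.mem_neighborFinset]

lemma mem_fartherNeighbors {w : V} :
    w ∈ fartherNeighbors G x y ↔ G.Adj y w ∧ G.dist x w = G.dist x y + 1 := by
  simp only [fartherNeighbors, mem_filter, SimpleGraph.mem_neighborFinset]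

lemma closerNeighbors_nonempty (h : G.dist x y ≠ 0) : (closerNeighbors G x y).Nonempty :=
  let ⟨w, hw⟩ := exists_adj_dist_add_one_eq h
  ⟨w, mem_closerNeighbors.2 hw⟩

lemma card_closerNeighbors_le_one (hg : ((2 * d : ℕ) : ℕ∞) ≤ G.egirth) (h : G.dist x y < d) :
    #(closerNeighbors G x y) ≤ 1 := by
  refine card_le_one.2 fun a ha b hb => ?_
  rw [mem_closerNeighbors] at ha hb
  exact eq_of_adj_of_dist_add_one_eq hg h ha.1 hb.1 ha.2 hb.2

lemma card_closerNeighbors_eq_one (hg : ((2 * d : ℕ) : ℕ∞) ≤ G.egirth) (h₀ : G.dist x y ≠ 0)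
    (h : G.dist x y < d) : #(closerNeighbors G x y) = 1 :=
  (card_closerNeighbors_le_one hg h).antisymm (closerNeighbors_nonempty h₀).card_pos

lemma card_closerNeighbors_add_card_fartherNeighbors (hg : ((2 * d : ℕ) : ℕ∞) ≤ G.egirth)
    (hxy : G.Reachable x y) (h : G.dist x y < d) :
    #(closerNeighbors G x y) + #(fartherNeighbors G x y) = G.degree y := by
  classical
  rw [← G.card_neighborFinset_eq_degree, ← card_union_of_disjoint]
  · congr 1
    ext w
    rw [mem_union, mem_closerNeighbors, mem_fartherNeighbors, ← and_or_left,
      SimpleGraph.mem_neighborFinset]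
    refine and_iff_left_of_imp fun hw => ?_
    have hne := dist_ne_dist_of_adj_of_dist_lt hg hxy h hw
    rcases hw.diff_dist_adj (u := x) with h | h | h <;> omega
  · refine disjoint_left.2 fun w hw hw' => ?_
    rw [mem_closerNeighbors] at hw
    rw [mem_fartherNeighbors] at hw'
    omega

lemma le_card_fartherNeighbors (hr : G.IsRegularOfDegree (q + 1))
    (hg : ((2 * d : ℕ) : ℕ∞) ≤ G.egirth) (hxy : G.Reachable x y) (h : G.dist x y < d) :
    q ≤ #(fartherNeighbors G x y) := by
  have hsum := card_closerNeighbors_add_card_fartherNeighbors hg hxy h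
  have hle := card_closerNeighbors_le_one hg h
  rw [hr y] at hsum
  omega

lemma card_closerNeighbors_le_comm (hg : ((2 * d : ℕ) : ℕ∞) ≤ G.egirth) (hc : G.Connected)
    (h₂ : 2 ≤ G.dist x y) (h : G.dist x y ≤ d) :
    #(closerNeighbors G x y) ≤ #(closerNeighbors G y x) := by
  refine card_le_card_of_forall_subsingleton (fun w z => G.dist z w + 2 = G.dist x y)
    (fun w hw => ?_) (fun z hz a ha b hb => ?_)
  · rw [mem_closerNeighbors] at hw
    obtain ⟨z, hz, hwz⟩ := exists_adj_dist_add_one_eq (G := G) (x := w) (y := x)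
      (by rw [SimpleGraph.dist_comm]; omega)
    have hxwy := hc.dist_triangle (u := x) (v := z) (w := y)
    have hywz := hc.dist_triangle (u := y) (v := w) (w := z)
    rw [SimpleGraph.dist_eq_one_iff_adj.2 hz] at hxwy
    rw [SimpleGraph.dist_eq_one_iff_adj.2 hw.1] at hywz
    have hzy := G.dist_comm (u := z) (v := y)
    have hxy := G.dist_comm (u := y) (v := x)
    have hxw := G.dist_comm (u := w) (v := x)
    have hzw := G.dist_comm (u := z) (v := w)
    exact ⟨z, mem_closerNeighbors.2 ⟨hz, by omega⟩, by omega⟩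
  · rw [mem_closerNeighbors, G.dist_comm (v := z), G.dist_comm (v := x)] at hz
    simp only [Set.mem_ofPred_eq, mem_closerNeighbors] at ha hb
    exact eq_of_adj_of_dist_add_one_eq (x := z) hg (by omega) ha.1.1 hb.1.1 (by omega) (by omega)

lemma card_closerNeighbors_comm (hg : ((2 * d : ℕ) : ℕ∞) ≤ G.egirth) (hc : G.Connected)
    (h₂ : 2 ≤ G.dist x y) (h : G.dist x y ≤ d) :
    #(closerNeighbors G x y) = #(closerNeighbors G y x) :=
  (card_closerNeighbors_le_comm hg hc h₂ h).antisymm <|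
    card_closerNeighbors_le_comm hg hc (by rwa [G.dist_comm]) (by rwa [G.dist_comm])

lemma disjoint_closerNeighbors_of_adj (hg : ((2 * d : ℕ) : ℕ∞) ≤ G.egirth) (hc : G.Connected)
    {u v : V} (huv : G.Adj u v) (hu : G.dist u y ≤ d) (h : G.dist u y = G.dist v y) :
    Disjoint (closerNeighbors G u y) (closerNeighbors G v y) := by
  refine disjoint_left.2 fun w hwu hwv => ?_
  rw [mem_closerNeighbors, G.dist_comm] at hwu hwv
  exact dist_ne_dist_of_adj_of_dist_lt hg (hc w u) (by omega) huv (by omega)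

end Neighbors

section Counting

variable {V : Type*} [Fintype V] {G : SimpleGraph V} {d e q : ℕ} {u v y : V}

/-- The vertices at distance `i` from `u` and at distance `i + 1` from `v`: for adjacent `u` and
`v`, the layers of the tree hanging off `u` when the edge `uv` is removed. -/
noncomputable def edgeSphere (G : SimpleGraph V) (u v : V) (i : ℕ) : Finset V :=
  {x | G.dist u x = i ∧ G.dist v x = i + 1}

/-- The union of the first `d` layers `edgeSphere G u v i`. -/
noncomputable def halfBall (G : SimpleGraph V) (d : ℕ) (u v : V) : Finset V :=
  {x | G.dist u x < d ∧ G.dist v x = G.dist u x + 1}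

open Classical in
/-- The vertices outside the Moore tree of depth `d` around the edge `uv`. -/
noncomputable def excessSet (G : SimpleGraph V) (d : ℕ) (u v : V) : Finset V :=
  (halfBall G d u v ∪ halfBall G d v u)ᶜ

lemma mem_edgeSphere {x : V} {i : ℕ} :
    x ∈ edgeSphere G u v i ↔ G.dist u x = i ∧ G.dist v x = i + 1 := by
  simp only [edgeSphere, mem_filter, mem_univ, true_and]

lemma mem_halfBall {x : V} :
    x ∈ halfBall G d u v ↔ G.dist u x < d ∧ G.dist v x = G.dist u x + 1 := by
  simp only [halfBall, mem_filter, mem_univ, true_and]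

lemma mem_excessSet {x : V} :
    x ∈ excessSet G d u v ↔ x ∉ halfBall G d u v ∧ x ∉ halfBall G d v u := by
  simp only [excessSet, mem_compl, mem_union, not_or]

lemma excessSet_comm : excessSet G d u v = excessSet G d v u := by
  classical
  rw [excessSet, excessSet, union_comm]

lemma mem_excessSet_of_le_dist {x : V} (hu : d ≤ G.dist u x) (hv : d ≤ G.dist v x) :
    x ∈ excessSet G d u v := by
  rw [mem_excessSet, mem_halfBall, mem_halfBall]
  omega

lemma mem_excessSet_of_not_reachable {x : V} (huv : G.Adj u v) (hux : ¬ G.Reachable u x) :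
    x ∈ excessSet G d u v := by
  have hvx : ¬ G.Reachable v x := fun h => hux (huv.reachable.trans h)
  rw [mem_excessSet, mem_halfBall, mem_halfBall, SimpleGraph.dist_eq_zero_of_not_reachable hux,
    SimpleGraph.dist_eq_zero_of_not_reachable hvx]
  omega

lemma disjoint_halfBall : Disjoint (halfBall G d u v) (halfBall G d v u) := by
  refine disjoint_left.2 fun x hx hy => ?_
  rw [mem_halfBall] at hx hy
  omega

variable [DecidableRel G.Adj]

lemma card_edgeSphere_mul_le (hr : G.IsRegularOfDegree (q + 1))
    (hg : ((2 * d : ℕ) : ℕ∞) ≤ G.egirth) (huv : G.Adj u v) {i : ℕ} (hi : i + 1 < d) :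
    #(edgeSphere G u v i) * q ≤ #(edgeSphere G u v (i + 1)) := by
  classical
  rw [← mul_one #(edgeSphere G u v (i + 1))]
  refine card_mul_le_card_mul G.Adj (fun a ha => ?_) (fun b hb => card_le_one.2 fun y hy z hz => ?_)
  · rw [mem_edgeSphere] at ha
    have hva : G.Reachable v a := SimpleGraph.Reachable.of_dist_ne_zero (by omega)
    refine (le_card_fartherNeighbors hr hg hva (by omega)).trans (card_le_card fun w hw => ?_)
    rw [mem_fartherNeighbors] at hw
    have huw := dist_le_dist_add_one_of_adj (x := u) hw.1
    have hvw := dist_le_dist_add_one_of_adj (x := w) huv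
    rw [G.dist_comm, G.dist_comm (v := u)] at hvw
    exact mem_bipartiteAbove _ |>.2 ⟨mem_edgeSphere.2 (by omega), hw.1⟩
  · simp only [mem_bipartiteBelow, mem_edgeSphere] at hb hy hz
    exact eq_of_adj_of_dist_add_one_eq (x := u) hg (by omega) hy.2.symm hz.2.symm
      (by omega) (by omega)

lemma pow_le_card_edgeSphere (hr : G.IsRegularOfDegree (q + 1))
    (hg : ((2 * d : ℕ) : ℕ∞) ≤ G.egirth) (huv : G.Adj u v) {i : ℕ} (hi : i < d) :
    q ^ i ≤ #(edgeSphere G u v i) := by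
  induction i with
  | zero => exact card_pos.2 ⟨u, mem_edgeSphere.2 ⟨SimpleGraph.dist_self,
      SimpleGraph.dist_eq_one_iff_adj.2 huv.symm⟩⟩
  | succ i ih =>
    rw [pow_succ]
    exact (Nat.mul_le_mul_right q (ih (by omega))).trans (card_edgeSphere_mul_le hr hg huv hi)

lemma sum_pow_le_card_halfBall (hr : G.IsRegularOfDegree (q + 1))
    (hg : ((2 * d : ℕ) : ℕ∞) ≤ G.egirth) (huv : G.Adj u v) :
    ∑ i ∈ range d, q ^ i ≤ #(halfBall G d u v) := by
  rw [card_eq_sum_card_fiberwise (f := G.dist u) (t := range d)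
    fun x hx => mem_coe.2 (mem_range.2 (mem_halfBall.1 hx).1)]
  refine sum_le_sum fun i hi => (pow_le_card_edgeSphere hr hg huv (mem_range.1 hi)).trans
    (card_le_card fun x hx => ?_)
  rw [mem_edgeSphere] at hx
  rw [mem_range] at hi
  exact mem_filter.2 ⟨mem_halfBall.2 (by omega), hx.1⟩

lemma card_excessSet_le (hr : G.IsRegularOfDegree (q + 1)) (hg : ((2 * d : ℕ) : ℕ∞) ≤ G.egirth)
    (hn : Fintype.card V ≤ 2 * ∑ i ∈ range d, q ^ i + e) (huv : G.Adj u v) :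
    #(excessSet G d u v) ≤ e := by
  classical
  have hcard := card_compl_add_card (halfBall G d u v ∪ halfBall G d v u)
  rw [card_union_of_disjoint disjoint_halfBall] at hcard
  have hu := sum_pow_le_card_halfBall hr hg huv
  have hv := sum_pow_le_card_halfBall hr hg huv.symm
  rw [excessSet]
  omega

lemma exists_not_mem_excessSet_of_adj (hr : G.IsRegularOfDegree (q + 1))
    (hg : ((2 * d : ℕ) : ℕ∞) ≤ G.egirth) (hn : Fintype.card V ≤ 2 * ∑ i ∈ range d, q ^ i + e)
    (he : e ≤ q) (huv : G.Adj u v) : ∃ w, G.Adj y w ∧ w ∉ excessSet G d u v := by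
  have hlt : #(excessSet G d u v) < #(G.neighborFinset y) := by
    rw [G.card_neighborFinset_eq_degree, hr y]
    exact Nat.lt_succ_of_le ((card_excessSet_le hr hg hn huv).trans he)
  simpa only [SimpleGraph.mem_neighborFinset] using exists_mem_notMem_of_card_lt_card hlt

lemma connected_of_card_le [Nonempty V] (hr : G.IsRegularOfDegree (q + 1))
    (hg : ((2 * d : ℕ) : ℕ∞) ≤ G.egirth) (hn : Fintype.card V ≤ 2 * ∑ i ∈ range d, q ^ i + e)
    (he : e ≤ q) : G.Connected := by
  refine (SimpleGraph.connected_iff _).2 ⟨fun u x => ?_, inferInstance⟩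
  obtain ⟨v, huv⟩ := (G.degree_pos_iff_exists_adj u).1 (hr u ▸ q.succ_pos)
  obtain ⟨w, hxw, hw⟩ := exists_not_mem_excessSet_of_adj (y := x) hr hg hn he huv
  by_contra hux
  exact hw (mem_excessSet_of_not_reachable huv fun huw => hux (huw.trans hxw.symm.reachable))

lemma dist_le_or_dist_le_of_adj (hr : G.IsRegularOfDegree (q + 1))
    (hg : ((2 * d : ℕ) : ℕ∞) ≤ G.egirth) (hn : Fintype.card V ≤ 2 * ∑ i ∈ range d, q ^ i + e)
    (he : e ≤ q) (huv : G.Adj u v) : G.dist u y ≤ d ∨ G.dist v y ≤ d := by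
  obtain ⟨w, hyw, hw⟩ := exists_not_mem_excessSet_of_adj (y := y) hr hg hn he huv
  by_contra! h
  have hu := dist_le_dist_add_one_of_adj (x := u) hyw.symm
  have hv := dist_le_dist_add_one_of_adj (x := v) hyw.symm
  exact hw (mem_excessSet_of_le_dist (by omega) (by omega))

lemma dist_le_add_one (hr : G.IsRegularOfDegree (q + 1)) (hg : ((2 * d : ℕ) : ℕ∞) ≤ G.egirth)
    (hn : Fintype.card V ≤ 2 * ∑ i ∈ range d, q ^ i + e) (he : e ≤ q) (x y : V) :
    G.dist x y ≤ d + 1 := by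
  obtain ⟨v, hxv⟩ := (G.degree_pos_iff_exists_adj x).1 (hr x ▸ q.succ_pos)
  have hyv := dist_le_dist_add_one_of_adj (x := y) hxv.symm
  rw [G.dist_comm, G.dist_comm (v := v)] at hyv
  rcases dist_le_or_dist_le_of_adj (y := y) hr hg hn he hxv with h | h <;> omega

end Counting

section Bipartite

variable {V : Type*} [Fintype V] {G : SimpleGraph V} [DecidableRel G.Adj] {d e q : ℕ} {u v p y : V}

lemma card_closerNeighbors_add_le_degree (hg : ((2 * d : ℕ) : ℕ∞) ≤ G.egirth) (hc : G.Connected)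
    (huv : G.Adj u v) (hu : G.dist u y ≤ d) (h : G.dist u y = G.dist v y) :
    #(closerNeighbors G u y) + #(closerNeighbors G v y) ≤ G.degree y := by
  classical
  rw [← G.card_neighborFinset_eq_degree,
    ← card_union_of_disjoint (disjoint_closerNeighbors_of_adj hg hc huv hu h)]
  exact card_le_card (union_subset (filter_subset _ _) (filter_subset _ _))

lemma dist_eq_of_mem_closerNeighbors (hg : ((2 * d : ℕ) : ℕ∞) ≤ G.egirth) (hc : G.Connected)
    (huv : G.Adj u v) (hu : G.dist u y = d) (hv : G.dist v y = d)
    (hp : p ∈ closerNeighbors G u y) : G.dist v p = d := by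
  rw [mem_closerNeighbors] at hp
  have hne := dist_ne_dist_of_adj_of_dist_lt hg (hc p u) (by rw [G.dist_comm]; omega) huv
  have hyp := dist_le_dist_add_one_of_adj (x := v) hp.1
  have hpy := dist_le_dist_add_one_of_adj (x := v) hp.1.symm
  have huv' := dist_le_dist_add_one_of_adj (x := p) huv
  rw [G.dist_comm, G.dist_comm (v := v)] at hne
  rw [G.dist_comm, G.dist_comm (v := u)] at huv'
  omega

lemma card_closerNeighbors_le_card_inter_excessSet [DecidableEq V]
    (hr : G.IsRegularOfDegree (q + 1)) (hg : ((2 * d : ℕ) : ℕ∞) ≤ G.egirth) (hd : 2 ≤ d)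
    (hc : G.Connected) (huv : G.Adj u v) (hu : G.dist u y = d) (hv : G.dist v y = d)
    (hp : p ∈ closerNeighbors G u y) :
    #(closerNeighbors G v y) ≤ #(G.neighborFinset p ∩ excessSet G d u v) := by
  have hvp := dist_eq_of_mem_closerNeighbors hg hc huv hu hv hp
  rw [mem_closerNeighbors] at hp
  have hsum := card_closerNeighbors_add_le_degree (y := v) hg hc hp.1
    (by rw [G.dist_comm, hv]) (by rw [G.dist_comm, hv, G.dist_comm, hvp])
  rw [card_closerNeighbors_comm hg hc (by rw [G.dist_comm]; omega) (by rw [G.dist_comm]; omega),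
    card_closerNeighbors_comm (x := p) hg hc (by rw [G.dist_comm]; omega)
      (by rw [G.dist_comm]; omega), hr v] at hsum
  have hcover : G.neighborFinset p ⊆
      closerNeighbors G v p ∪ G.neighborFinset p ∩ excessSet G d u v := fun w hw => by
    rw [mem_union, mem_inter, mem_closerNeighbors, mem_excessSet, mem_halfBall, mem_halfBall]
    refine or_iff_not_imp_left.2 fun hfar => ⟨hw, ?_⟩
    rw [SimpleGraph.mem_neighborFinset] at hw
    have hvw := dist_le_dist_add_one_of_adj (x := v) hw
    have hwv := dist_le_dist_add_one_of_adj (x := v) hw.symm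
    have huw_ne := dist_ne_dist_of_adj_of_dist_lt hg (hc u p) (by omega) hw
    have hvw_ne : G.dist v w + 1 ≠ d := fun h => hfar ⟨hw, h.trans hvp.symm⟩
    omega
  have hcard := (card_le_card hcover).trans (card_union_le _ _)
  rw [G.card_neighborFinset_eq_degree, hr p] at hcard
  omega

lemma degree_le_card_closerNeighbors_add [DecidableEq V] (hu : G.dist u y = d)
    (hv : G.dist v y = d) :
    G.degree y ≤ #(closerNeighbors G u y) + #(closerNeighbors G v y) +
      #(G.neighborFinset y ∩ excessSet G d u v) := by
  rw [← G.card_neighborFinset_eq_degree]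
  refine (card_le_card (t := closerNeighbors G u y ∪ closerNeighbors G v y ∪
      G.neighborFinset y ∩ excessSet G d u v) fun w hw => ?_).trans
    ((card_union_le _ _).trans (Nat.add_le_add_right (card_union_le _ _) _))
  rw [mem_union, mem_union, mem_inter, mem_closerNeighbors, mem_closerNeighbors]
  by_cases hfar : d ≤ G.dist u w ∧ d ≤ G.dist v w
  · exact Or.inr ⟨hw, mem_excessSet_of_le_dist hfar.1 hfar.2⟩
  · rw [SimpleGraph.mem_neighborFinset] at hw
    have huw := dist_le_dist_add_one_of_adj (x := u) hw.symm
    have hvw := dist_le_dist_add_one_of_adj (x := v) hw.symm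
    by_cases hdu : G.dist u w + 1 = G.dist u y
    · exact Or.inl (Or.inl ⟨hw, hdu⟩)
    · exact Or.inl (Or.inr ⟨hw, by omega⟩)

lemma sum_card_neighborFinset_inter_le [DecidableEq V] (hg : 4 < G.egirth) {r : V}
    (hp : G.Adj y p) (hr : G.Adj y r) (hpr : p ≠ r) (X : Finset V) :
    #(G.neighborFinset p ∩ X) + #(G.neighborFinset r ∩ X) + #(G.neighborFinset y ∩ X) ≤
      #X + 1 := by
  have hg₃ : 3 < G.egirth := lt_trans (by norm_num) hg
  have hinter : #((G.neighborFinset p ∩ X) ∩ (G.neighborFinset r ∩ X)) ≤ 1 := by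
    have : Nonempty V := ⟨y⟩
    refine card_le_one_iff_subset_singleton.2 ⟨y, fun w hw => ?_⟩
    simp only [mem_inter, SimpleGraph.mem_neighborFinset] at hw
    exact mem_singleton.2 (eq_of_two_common_neighbors hg hpr hw.1.1 hw.2.1 hp.symm hr.symm)
  have hdisj : Disjoint (G.neighborFinset p ∩ X ∪ G.neighborFinset r ∩ X)
      (G.neighborFinset y ∩ X) := by
    refine disjoint_left.2 fun w hw hw' => ?_
    simp only [mem_union, mem_inter, SimpleGraph.mem_neighborFinset] at hw hw'
    rcases hw with hw | hw
    · exact not_adj_of_common_neighbor hg₃ hp hw'.1 hw.1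
    · exact not_adj_of_common_neighbor hg₃ hr hw'.1 hw.1
  have hsub : G.neighborFinset p ∩ X ∪ G.neighborFinset r ∩ X ∪ G.neighborFinset y ∩ X ⊆ X :=
    union_subset (union_subset inter_subset_right inter_subset_right) inter_subset_right
  have hcard := card_le_card hsub
  rw [card_union_of_disjoint hdisj] at hcard
  have := card_union_add_card_inter (G.neighborFinset p ∩ X) (G.neighborFinset r ∩ X)
  omega

lemma dist_ne_of_adj_of_dist_eq (hr : G.IsRegularOfDegree (q + 1))
    (hg : ((2 * d : ℕ) : ℕ∞) ≤ G.egirth) (hn : Fintype.card V ≤ 2 * ∑ i ∈ range d, q ^ i + e)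
    (he : e < q) (hd : 3 ≤ d) (hc : G.Connected) (huv : G.Adj u v) (hu : G.dist u y = d) :
    G.dist v y ≠ d := by
  classical
  intro hv
  -- The neighbours `p` and `r` of `y` closer to `u` and to `v` would, together with `y`, have too
  -- many neighbours in the excess set.
  obtain ⟨p, hp⟩ := closerNeighbors_nonempty (G := G) (x := u) (y := y) (by omega)
  obtain ⟨r, hrv⟩ := closerNeighbors_nonempty (G := G) (x := v) (y := y) (by omega)
  have hpr : p ≠ r := fun h => disjoint_left.1
    (disjoint_closerNeighbors_of_adj hg hc huv hu.le (hu.trans hv.symm)) hp (h ▸ hrv)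
  have hNp := card_closerNeighbors_le_card_inter_excessSet hr hg (by omega) hc huv hu hv hp
  have hNr := card_closerNeighbors_le_card_inter_excessSet hr hg (by omega) hc huv.symm hv hu hrv
  have hNy := degree_le_card_closerNeighbors_add hu hv
  have hX := card_excessSet_le hr hg hn huv
  have hsum := sum_card_neighborFinset_inter_le
    (lt_of_lt_of_le (by exact_mod_cast (by omega : 4 < 2 * d)) hg)
    (mem_closerNeighbors.1 hp).1 (mem_closerNeighbors.1 hrv).1 hpr (excessSet G d u v)
  rw [excessSet_comm] at hNr
  rw [hr y] at hNy
  omega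

lemma dist_ne_dist_of_adj (hr : G.IsRegularOfDegree (q + 1))
    (hg : ((2 * d : ℕ) : ℕ∞) ≤ G.egirth) (hn : Fintype.card V ≤ 2 * ∑ i ∈ range d, q ^ i + e)
    (he : e < q) (hd : 3 ≤ d) (hc : G.Connected) (huv : G.Adj u v) :
    G.dist y u ≠ G.dist y v := by
  intro h
  rcases lt_trichotomy (G.dist y u) d with hlt | heq | hgt
  · exact dist_ne_dist_of_adj_of_dist_lt hg (hc y u) hlt huv h
  · exact dist_ne_of_adj_of_dist_eq hr hg hn he hd hc huv (y := y) (by rw [G.dist_comm, heq])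
      (by rw [G.dist_comm, ← h, heq])
  · have := dist_le_or_dist_le_of_adj (y := y) hr hg hn he.le huv
    rw [G.dist_comm, G.dist_comm (u := v)] at this
    omega

lemma nonempty_coloring_bool (hr : G.IsRegularOfDegree (q + 1))
    (hg : ((2 * d : ℕ) : ℕ∞) ≤ G.egirth) (hn : Fintype.card V ≤ 2 * ∑ i ∈ range d, q ^ i + e)
    (he : e < q) (hd : 3 ≤ d) (hc : G.Connected) : Nonempty (G.Coloring Bool) := by
  obtain ⟨o⟩ := hc.nonempty
  refine ⟨.mk (fun x => decide (Even (G.dist o x))) fun {a b} hab h => ?_⟩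
  have hne := dist_ne_dist_of_adj (y := o) hr hg hn he hd hc hab
  have hle := dist_le_dist_add_one_of_adj (x := o) hab
  have hge := dist_le_dist_add_one_of_adj (x := o) hab.symm
  rw [decide_eq_decide, Nat.even_iff, Nat.even_iff] at h
  omega

end Bipartite

section Dickson

variable {R : Type*} [CommRing R] {a : R}

lemma isMonicOfDegree_dickson_two [Nontrivial R] (a : R) :
    ∀ n, IsMonicOfDegree (dickson 2 a n) n
  | 0 => isMonicOfDegree_zero_iff.2 (by rw [dickson_zero]; norm_num)
  | 1 => isMonicOfDegree_X R
  | n + 2 => by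
    rw [dickson_add_two, show n + 2 = 1 + (n + 1) by ring]
    refine ((isMonicOfDegree_X R).mul (isMonicOfDegree_dickson_two a (n + 1))).sub ?_
    have := (natDegree_C_mul_le a _).trans (isMonicOfDegree_dickson_two a n).natDegree_eq.le
    omega

lemma eval_add_one_dickson_two (a : R) :
    ∀ n, (dickson 2 a n).eval (a + 1) = ∑ i ∈ range (n + 1), a ^ i
  | 0 => by rw [dickson_zero]; norm_num
  | 1 => by rw [dickson_one, eval_X, sum_range_succ, sum_range_one]; ring
  | n + 2 => by
    rw [dickson_add_two, eval_sub, eval_mul, eval_mul, eval_X, eval_C,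
      eval_add_one_dickson_two a (n + 1), eval_add_one_dickson_two a n, sum_range_succ _ (n + 2),
      sum_range_succ _ (n + 1)]
    ring

lemma coeff_dickson_two_mem {I : Ideal R} (ha : a ∈ I) {n i : ℕ} (hi : i ≠ n) :
    (dickson 2 a n).coeff i ∈ I := by
  rw [← Ideal.Quotient.eq_zero_iff_mem, ← coeff_map, map_dickson,
    Ideal.Quotient.eq_zero_iff_mem.2 ha, dickson_two_zero, coeff_X_pow, if_neg hi]

lemma coeff_zero_dickson_two_mem_sq {I : Ideal R} (ha : a ∈ I) {n : ℕ} (hn : 3 ≤ n) :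
    (dickson 2 a n).coeff 0 ∈ I ^ 2 := by
  obtain ⟨m, rfl⟩ := Nat.exists_eq_add_of_le' (show 2 ≤ n by omega)
  rw [dickson_add_two, coeff_sub, mul_coeff_zero, coeff_X_zero, zero_mul, coeff_C_mul, zero_sub,
    neg_mem_iff, sq]
  exact Ideal.mul_mem_mul ha (coeff_dickson_two_mem ha (by omega))

lemma isEisensteinAt_dickson_two_add_C {P : Ideal R} (hP : P.IsPrime) {c : R} (ha : a ∈ P)
    (hc : c ∈ P) (hc' : c ∉ P ^ 2) {n : ℕ} (hn : 3 ≤ n) :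
    (dickson 2 a n + C c).IsEisensteinAt P := by
  have : Nontrivial R := ⟨c, 0, fun h => hc' (h ▸ zero_mem _)⟩
  have hmon : IsMonicOfDegree (dickson 2 a n + C c) n :=
    (isMonicOfDegree_dickson_two a n).add_right (by rw [natDegree_C]; omega)
  refine ⟨hmon.monic.leadingCoeff_notMem hP.ne_top, fun {i} hi => ?_, fun h => hc' ?_⟩
  · rw [hmon.natDegree_eq] at hi
    rw [coeff_add, coeff_C]
    refine add_mem (coeff_dickson_two_mem ha hi.ne) ?_
    split_ifs
    exacts [hc, zero_mem P]
  · rw [coeff_add, coeff_C_zero] at h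
    exact (Ideal.add_mem_iff_right _ (coeff_zero_dickson_two_mem_sq ha hn)).1 h

lemma irreducible_dickson_two_add_C (K : Type*) [Field K] [Algebra R K] [IsFractionRing R K]
    [IsDomain R] [IsIntegrallyClosed R] {P : Ideal R} (hP : P.IsPrime) {c : R} (ha : a ∈ P)
    (hc : c ∈ P) (hc' : c ∉ P ^ 2) {n : ℕ} (hn : 3 ≤ n) :
    Irreducible (dickson 2 (algebraMap R K a) n + C (algebraMap R K c)) := by
  have hmon : IsMonicOfDegree (dickson 2 a n + C c) n :=
    (isMonicOfDegree_dickson_two a n).add_right (by rw [natDegree_C]; omega)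
  have hirr := (isEisensteinAt_dickson_two_add_C hP ha hc hc' hn).irreducible hP
    hmon.monic.isPrimitive (by rw [hmon.natDegree_eq]; omega)
  simpa only [Polynomial.map_add, map_dickson, map_C] using
    (hmon.monic.irreducible_iff_irreducible_map_fraction_map (K := K)).1 hirr

end Dickson

section LinearAlgebra

open Module

variable {K M : Type*} [Field K] [AddCommGroup M] [Module K M]

lemma natDegree_dvd_finrank_of_aeval_eq_zero [FiniteDimensional K M] {p : K[X]}
    (hp : Irreducible p) {f : End K M} (hf : aeval f p = 0) : p.natDegree ∣ finrank K M := by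
  have : Fact (Irreducible p) := ⟨hp⟩
  let φ : AdjoinRoot p →ₐ[K] End K M :=
    Ideal.Quotient.liftₐ (Ideal.span {p}) (aeval f) fun a ha => by
      obtain ⟨b, rfl⟩ := Ideal.mem_span_singleton.1 ha
      rw [map_mul, hf, zero_mul]
  let _ : Module (AdjoinRoot p) M := Module.compHom M φ.toRingHom
  have : IsScalarTower K (AdjoinRoot p) M := ⟨fun a b w => by
    change φ (a • b) w = a • φ b w
    rw [map_smul, LinearMap.smul_apply]⟩
  have := (AdjoinRoot.powerBasis hp.ne_zero).finite
  rw [← finrank_mul_finrank K (AdjoinRoot p) M, (AdjoinRoot.powerBasis hp.ne_zero).finrank,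
    AdjoinRoot.powerBasis_dim]
  exact dvd_mul_right _ _

lemma coe_aeval_restrict {f : End K M} {W : Submodule K M} (hW : ∀ w ∈ W, f w ∈ W) (p : K[X])
    (w : W) : (aeval (f.restrict hW) p w : M) = aeval f p w := by
  induction p using Polynomial.induction_on' with
  | add p r hp hr => simp only [map_add, LinearMap.add_apply, Submodule.coe_add, hp, hr]
  | monomial n c =>
    simp only [aeval_monomial, algebraMap_end_eq_smul_id, End.mul_apply, LinearMap.smul_apply,
      LinearMap.id_apply, Submodule.coe_smul]
    rw [End.pow_restrict, LinearMap.coe_restrict_apply]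

lemma natDegree_dvd_finrank_inf_ker_aeval [FiniteDimensional K M] {p : K[X]}
    (hp : Irreducible p) {f : End K M} {U : Submodule K M} (hU : ∀ u ∈ U, f u ∈ U) :
    p.natDegree ∣ finrank K (U ⊓ (aeval f p).ker : Submodule K M) := by
  have hcomm : Commute (aeval f p) f := by
    simpa only [aeval_X] using (Commute.all p X).map (aeval f)
  have hW : ∀ w ∈ U ⊓ (aeval f p).ker, f w ∈ U ⊓ (aeval f p).ker := by
    rintro w ⟨hwU, hw : aeval f p w = 0⟩
    refine ⟨hU w hwU, LinearMap.mem_ker.2 ?_⟩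
    rw [← End.mul_apply, hcomm.eq, End.mul_apply, hw, map_zero]
  exact natDegree_dvd_finrank_of_aeval_eq_zero hp (f := f.restrict hW) <| LinearMap.ext fun w =>
    Subtype.ext ((coe_aeval_restrict hW p w).trans w.2.2)

lemma finrank_inf_ker_add_one [FiniteDimensional K M] {W : Submodule K M} {φ : Dual K M} {w : M}
    (hw : w ∈ W) (h : φ w ≠ 0) : finrank K (W ⊓ φ.ker : Submodule K M) + 1 = finrank K W := by
  have hφ : φ.domRestrict W ≠ 0 := fun h₀ => h (LinearMap.congr_fun h₀ ⟨w, hw⟩)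
  rw [← Dual.finrank_ker_add_one_of_ne_zero hφ, LinearMap.ker_domRestrict,
    ← Submodule.finrank_map_subtype_eq W, Submodule.map_comap_subtype]

lemma toLin'_aeval {ι : Type*} [Fintype ι] [DecidableEq ι] (A : Matrix ι ι K) (p : K[X]) :
    toLin' (aeval A p) = aeval (toLin' A) p :=
  (aeval_algHom_apply (toLinAlgEquiv' (R := K) (n := ι)).toAlgHom A p).symm

end LinearAlgebra

section AdjMatrix

variable {V : Type*} {R : Type*} [CommRing R] {G : SimpleGraph V} {d q n : ℕ}

/-- The matrix whose `(x, y)` entry is `1` if the distance of `x` and `y` is one of `i`, `i - 2`,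
`i - 4`, … and `0` otherwise. For `i` less than half the girth of a regular graph it is a
polynomial in the adjacency matrix, because it counts the nonbacktracking walks of lengths `i`,
`i - 2`, … -/
noncomputable def parityBallMatrix (G : SimpleGraph V) (R : Type*) [CommRing R] (i : ℕ) :
    Matrix V V R :=
  of fun x y => if G.dist x y ≤ i ∧ Even (i + G.dist x y) then 1 else 0

lemma parityBallMatrix_apply (i : ℕ) (x y : V) :
    parityBallMatrix G R i x y = if G.dist x y ≤ i ∧ Even (i + G.dist x y) then 1 else 0 := rfl

lemma parityBallMatrix_zero [DecidableEq V] (hc : G.Connected) :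
    parityBallMatrix G R 0 = 1 := by
  ext x y
  simp only [parityBallMatrix_apply, Nat.le_zero, hc.dist_eq_zero_iff, Matrix.one_apply]
  refine if_congr (and_iff_left_of_imp ?_) rfl rfl
  rintro rfl
  simp

lemma parityBallMatrix_one [DecidableRel G.Adj] : parityBallMatrix G R 1 = G.adjMatrix R := by
  ext x y
  rw [parityBallMatrix_apply, SimpleGraph.adjMatrix_apply]
  refine if_congr ?_ rfl rfl
  rw [← SimpleGraph.dist_eq_one_iff_adj]
  grind

variable [Fintype V] [DecidableRel G.Adj]

lemma parityBallMatrix_mul_adjMatrix (hr : G.IsRegularOfDegree (q + 1))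
    (hg : ((2 * d : ℕ) : ℕ∞) ≤ G.egirth) (hc : G.Connected) (hn : n + 2 < d) :
    parityBallMatrix G R (n + 1) * G.adjMatrix R =
      parityBallMatrix G R (n + 2) + (q : R) • parityBallMatrix G R n := by
  ext x y
  have hclose {w : V} (hw : w ∈ G.neighborFinset y) :
      (G.dist x w = G.dist x y + 1 ∨ G.dist x w + 1 = G.dist x y) ∨ d ≤ G.dist x y := by
    rw [SimpleGraph.mem_neighborFinset] at hw
    have hne := dist_ne_dist_of_adj_of_dist_lt hg (hc x y) (b := w)
    rcases hw.diff_dist_adj (u := x) with h | h | h <;> grind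
  simp only [SimpleGraph.mul_adjMatrix_apply, Matrix.add_apply, Matrix.smul_apply,
    parityBallMatrix_apply, sum_boole, smul_eq_mul, mul_ite, mul_one, mul_zero]
  have hlow {w : V} (hw : w ∈ G.neighborFinset y) : G.dist x y ≤ G.dist x w + 1 :=
    dist_le_dist_add_one_of_adj ((G.mem_neighborFinset y w).1 hw).symm
  by_cases hodd : n + 2 < G.dist x y ∨ ¬ Even (n + G.dist x y)
  · rw [filter_false_of_mem (fun w hw => by grind), if_neg (by grind), if_neg (by grind)]
    simp
  obtain ⟨hle, heven⟩ := not_or.1 hodd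
  rw [not_lt] at hle
  rw [not_not] at heven
  by_cases heq : G.dist x y = n + 2
  · have : {w ∈ G.neighborFinset y | G.dist x w ≤ n + 1 ∧ Even (n + 1 + G.dist x w)} =
        closerNeighbors G x y := filter_congr fun w hw => by grind
    rw [this, card_closerNeighbors_eq_one hg (by omega) (by omega), if_pos (by grind),
      if_neg (by grind)]
    simp
  · rw [filter_true_of_mem (fun w hw => by grind), if_pos (by grind), if_pos (by grind),
      G.card_neighborFinset_eq_degree, hr y]
    push_cast
    ring

lemma aeval_adjMatrix_dickson_two [DecidableEq V] (hr : G.IsRegularOfDegree (q + 1))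
    (hg : ((2 * d : ℕ) : ℕ∞) ≤ G.egirth) (hc : G.Connected) :
    ∀ {n : ℕ}, n < d → aeval (G.adjMatrix R) (dickson 2 (q : R) n) = parityBallMatrix G R n
  | 0, _ => by
    rw [parityBallMatrix_zero hc, dickson_zero]
    norm_num
  | 1, _ => by rw [parityBallMatrix_one, dickson_one, aeval_X]
  | n + 2, hn => by
    rw [dickson_add_two, mul_comm X, map_sub, map_mul, map_mul, aeval_X, aeval_C,
      aeval_adjMatrix_dickson_two hr hg hc (by omega),
      aeval_adjMatrix_dickson_two hr hg hc (by omega),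
      parityBallMatrix_mul_adjMatrix hr hg hc hn, ← Algebra.smul_def, add_sub_cancel_right]

end AdjMatrix

section CycleGraph

variable {V W : Type*} {G : SimpleGraph V} {H : SimpleGraph W} [G.LocallyFinite] [H.LocallyFinite]
  {r : ℕ}

lemma nonempty_iso_of_bijective_hom (hG : G.IsRegularOfDegree r) (hH : H.IsRegularOfDegree r)
    (f : G →g H) (hf : Function.Bijective f) : Nonempty (G ≃g H) := by
  classical
  refine ⟨⟨Equiv.ofBijective f hf, fun {a b} => ⟨fun hab => ?_, f.map_adj⟩⟩⟩
  have himage : (G.neighborFinset a).image f = H.neighborFinset (f a) := by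
    refine eq_of_subset_of_card_le (image_subset_iff.2 fun c hc => ?_) ?_
    · rw [SimpleGraph.mem_neighborFinset] at hc ⊢
      exact f.map_adj hc
    · rw [card_image_of_injective _ hf.1, SimpleGraph.card_neighborFinset_eq_degree,
        SimpleGraph.card_neighborFinset_eq_degree, hG, hH]
  have hb : f b ∈ (G.neighborFinset a).image f := himage ▸ (H.mem_neighborFinset _ _).2 hab
  obtain ⟨c, hc, hcb⟩ := mem_image.1 hb
  exact hf.1 hcb ▸ (G.mem_neighborFinset _ _).1 hc

lemma exists_isHamiltonianCycle [DecidableEq V] [Finite V] (hc : G.Connected)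
    (hG : G.IsRegularOfDegree 2) : ∃ (v : V) (p : G.Walk v v), p.IsHamiltonianCycle := by
  have hncard (v : V) : (G.neighborSet v).ncard = 2 := by
    rw [Set.ncard_eq_toFinset_card']
    exact hG v
  have hcycles : G.IsCycles := fun v _ => hncard v
  obtain ⟨v⟩ := hc.nonempty
  obtain ⟨p, hp, hverts⟩ := hcycles.exists_cycle_toSubgraph_verts_eq_connectedComponentSupp
    (c := G.connectedComponentMk v) rfl (Set.nonempty_of_ncard_ne_zero (by simp [hncard]))
  refine ⟨v, p, hp, hp.isPath_tail.isHamiltonian_of_mem fun w => ?_⟩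
  have hw : w ∈ p.toSubgraph.verts :=
    hverts ▸ SimpleGraph.ConnectedComponent.sound (hc.preconnected w v)
  rw [SimpleGraph.Walk.mem_verts_toSubgraph] at hw
  rw [SimpleGraph.Walk.support_tail_of_not_nil p hp.not_nil]
  rcases (SimpleGraph.Walk.mem_support_iff p).1 hw with rfl | hw
  · exact SimpleGraph.Walk.end_mem_tail_support hp.not_nil
  · exact hw

lemma exists_nonempty_iso_cycleGraph [Finite V] (hc : G.Connected) (hG : G.IsRegularOfDegree 2) :
    ∃ l, 3 ≤ l ∧ Nonempty (G ≃g SimpleGraph.cycleGraph l) := by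
  classical
  have := Fintype.ofFinite V
  obtain ⟨v, p, hp⟩ := exists_isHamiltonianCycle hc hG
  have hl : 3 ≤ Fintype.card V := hp.length_eq ▸ hp.isCycle.three_le_length
  obtain ⟨f⟩ := (SimpleGraph.cycleGraph_isContained_iff hl).2 ⟨v, p, hp.isCycle, hp.length_eq⟩
  have hf : Function.Bijective f.toHom :=
    (Fintype.bijective_iff_injective_and_card _).2 ⟨f.injective, Fintype.card_fin _⟩
  have hcycle : (SimpleGraph.cycleGraph (Fintype.card V)).IsRegularOfDegree 2 := by
    obtain ⟨m, hm⟩ := Nat.exists_eq_add_of_le' hl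
    rw [hm]
    exact fun _ => SimpleGraph.cycleGraph_degree_three_le
  obtain ⟨φ⟩ := nonempty_iso_of_bijective_hom hcycle hG f.toHom hf
  exact ⟨_, hl, ⟨φ.symm⟩⟩

lemma isRegularOfDegree_toSimpleGraph {C : G.ConnectedComponent} [C.toSimpleGraph.LocallyFinite]
    (hG : G.IsRegularOfDegree r) : C.toSimpleGraph.IsRegularOfDegree r := by
  intro x
  have himage : (C.toSimpleGraph.neighborFinset x).map (.subtype (· ∈ C.supp)) =
      G.neighborFinset x := by
    ext y
    simp only [mem_map, SimpleGraph.mem_neighborFinset, Function.Embedding.subtype_apply]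
    exact ⟨fun ⟨_, hz, hzy⟩ => hzy ▸ hz,
      fun hy => ⟨⟨y, (C.mem_supp_congr_adj hy).1 x.2⟩, hy, rfl⟩⟩
  rw [← SimpleGraph.card_neighborFinset_eq_degree, ← card_map, himage,
    SimpleGraph.card_neighborFinset_eq_degree, hG]

lemma isDisjointUnionOfCycles [Finite V] (hG : G.IsRegularOfDegree 2) :
    IsDisjointUnionOfCycles G := by
  classical
  have := Fintype.ofFinite V
  exact fun C => exists_nonempty_iso_cycleGraph C.connected_toSimpleGraph
    (isRegularOfDegree_toSimpleGraph hG)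

end CycleGraph

section SignSpace

variable {V : Type*} {H : SimpleGraph V} {K : Type*} [Field K] {t : K} {f : V → K}

/-- The functions that are multiplied by `t` along each edge of `H`. When `H` is regular and
`t = ±1`, this is an eigenspace of the adjacency matrix, and its dimension counts the connected
components of `H` (if `t = 1`) or the bipartite ones (if `t = -1`). -/
def signSpace (H : SimpleGraph V) (t : K) : Submodule K (V → K) where
  carrier := {f | ∀ x y, H.Adj x y → f x = t * f y}
  add_mem' hf hg x y h := by rw [Pi.add_apply, Pi.add_apply, hf x y h, hg x y h, mul_add]
  zero_mem' x y _ := (mul_zero t).symm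
  smul_mem' c f hf x y h := by
    rw [Pi.smul_apply, Pi.smul_apply, hf x y h, smul_eq_mul, smul_eq_mul, mul_left_comm]

lemma one_mem_signSpace_one : (1 : V → K) ∈ signSpace H 1 := fun _ _ _ => (one_mul 1).symm

lemma eq_pow_mul_of_mem_signSpace (hf : f ∈ signSpace H t) {x y : V} (p : H.Walk x y) :
    f x = t ^ p.length * f y := by
  induction p with
  | nil => simp
  | cons h p ih => rw [hf _ _ h, ih, SimpleGraph.Walk.length_cons, pow_succ', mul_assoc]

lemma ne_zero_of_mem_signSpace (hf : f ∈ signSpace H t) {x y : V} (hxy : H.Reachable x y)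
    (hx : f x ≠ 0) : f y ≠ 0 := by
  obtain ⟨p⟩ := hxy
  rw [eq_pow_mul_of_mem_signSpace hf p] at hx
  exact right_ne_zero_of_mul hx

lemma signSpace_le_signSpace_excessGraph (G : SimpleGraph V) (d : ℕ) (t : K) :
    signSpace G t ≤ signSpace (excessGraph G d) (t ^ (d + 1)) := by
  intro f hf x y (hxy : G.dist x y = d + 1)
  obtain ⟨p, hp⟩ := SimpleGraph.exists_walk_of_dist_ne_zero (G := G) (u := x) (v := y) (by omega)
  rw [eq_pow_mul_of_mem_signSpace hf p, hp, hxy]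

section Components

/-- The connected components of `H` on which `signSpace H t` is not zero. -/
def signComponents (H : SimpleGraph V) (t : K) : Set H.ConnectedComponent :=
  {C | ∃ f ∈ signSpace H t, ∃ x, H.connectedComponentMk x = C ∧ f x ≠ 0}

lemma reachable_out (x : V) : H.Reachable x (Quot.out (H.connectedComponentMk x)) :=
  SimpleGraph.ConnectedComponent.exact (Quot.out_eq _).symm

lemma eq_zero_of_mem_signSpace (hf : f ∈ signSpace H t)
    (h : ∀ C ∈ signComponents H t, f (Quot.out C) = 0) : f = 0 := by
  funext x
  by_contra hx
  exact ne_zero_of_mem_signSpace hf (reachable_out x) hx (h _ ⟨f, hf, x, rfl, hx⟩)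

lemma exists_mem_signSpace_forall_eq (g : signComponents H t → K) :
    ∃ f ∈ signSpace H t, ∀ C : signComponents H t, f (Quot.out C.1) = g C := by
  classical
  have hne (C : signComponents H t) : ∃ f ∈ signSpace H t, f (Quot.out C.1) ≠ 0 := by
    obtain ⟨f, hf, x, hx, hfx⟩ := C.2
    exact ⟨f, hf, hx ▸ ne_zero_of_mem_signSpace hf (reachable_out x) hfx⟩
  choose σ hσ hσ₀ using hne
  let f (x : V) : K := if hC : H.connectedComponentMk x ∈ signComponents H t then
    g ⟨_, hC⟩ / σ ⟨_, hC⟩ (Quot.out (H.connectedComponentMk x)) * σ ⟨_, hC⟩ x else 0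
  refine ⟨f, fun x y hxy => ?_, fun C => ?_⟩
  · have hC : H.connectedComponentMk x = H.connectedComponentMk y :=
      SimpleGraph.ConnectedComponent.sound hxy.reachable
    simp only [f, hC]
    split_ifs with h
    · rw [hσ _ x y hxy, mul_left_comm]
    · rw [mul_zero]
  · have hC : H.connectedComponentMk (Quot.out C.1) = C.1 := Quot.out_eq _
    simp only [f, hC, Subtype.coe_eta, dif_pos C.2]
    exact div_mul_cancel₀ _ (hσ₀ C)

lemma finrank_signSpace [Finite V] :
    Module.finrank K (signSpace H t) = (signComponents H t).ncard := by
  have := Fintype.ofFinite (signComponents H t)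
  let evalOut : signSpace H t →ₗ[K] signComponents H t → K :=
    LinearMap.funLeft K K (fun C => Quot.out C.1) ∘ₗ (signSpace H t).subtype
  have hinj : Function.Injective evalOut := (injective_iff_map_eq_zero _).2 fun f hf =>
    Subtype.ext <| eq_zero_of_mem_signSpace f.2 fun C hC => congrFun hf ⟨C, hC⟩
  have hsurj : Function.Surjective evalOut := fun g =>
    let ⟨f, hf, hfg⟩ := exists_mem_signSpace_forall_eq g
    ⟨⟨f, hf⟩, funext hfg⟩
  rw [(LinearEquiv.ofBijective evalOut ⟨hinj, hsurj⟩).finrank_eq,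
    Module.finrank_fintype_fun_eq_card, ← Nat.card_eq_fintype_card, Nat.card_coe_set_eq]

lemma signComponents_one : signComponents H (1 : K) = Set.univ :=
  Set.eq_univ_of_forall fun C => C.ind fun x => ⟨1, one_mem_signSpace_one, x, rfl, one_ne_zero⟩

/-- The function with values `1` and `-1` on the two colour classes of a two-colouring. -/
def colorSign (K : Type*) [Field K] (c : H.Coloring Bool) (x : V) : K := if c x then 1 else -1

lemma colorSign_mul_self (c : H.Coloring Bool) (x : V) : colorSign K c x * colorSign K c x = 1 := by
  rw [colorSign]
  split_ifs <;> simp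

lemma colorSign_mem_signSpace (c : H.Coloring Bool) : colorSign K c ∈ signSpace H (-1) := by
  intro x y hxy
  have hne := c.valid hxy
  cases hx : c x <;> cases hy : c y <;> simp_all [colorSign]

lemma mem_signComponents_neg_one [LinearOrder K] [IsStrictOrderedRing K]
    {C : H.ConnectedComponent} :
    C ∈ signComponents H (-1 : K) ↔ Nonempty (C.toSimpleGraph.Coloring Bool) := by
  classical
  constructor
  · rintro ⟨f, hf, x, rfl, hx⟩
    refine ⟨.mk (fun y => decide (0 < f y)) fun {y z} hyz => ?_⟩
    have hz : f z ≠ 0 :=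
      ne_zero_of_mem_signSpace hf (SimpleGraph.ConnectedComponent.exact z.2.symm) hx
    rw [hf y z hyz]
    rcases hz.lt_or_gt with h | h <;> simp [h, h.le]
  · rintro ⟨c⟩
    obtain ⟨x, hx⟩ := C.exists_rep
    refine ⟨fun y => if hy : y ∈ C.supp then colorSign K c ⟨y, hy⟩ else 0, fun y z hyz => ?_,
      x, hx, ?_⟩
    · have hiff : y ∈ C.supp ↔ z ∈ C.supp := C.mem_supp_congr_adj hyz
      by_cases hy : y ∈ C.supp
      · simp only [dif_pos hy, dif_pos (hiff.1 hy)]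
        exact colorSign_mem_signSpace c _ _ hyz
      · simp only [dif_neg hy, dif_neg (mt hiff.2 hy), mul_zero]
    · simp only [dif_pos (show x ∈ C.supp from hx)]
      exact left_ne_zero_of_mul_eq_one (colorSign_mul_self c _)

end Components

section Cycles

lemma IsCycleOfLength.nonempty_coloring_bool_iff {C : H.ConnectedComponent} {l : ℕ}
    (h : IsCycleOfLength C l) : Nonempty (C.toSimpleGraph.Coloring Bool) ↔ Even l := by
  obtain ⟨hl, ⟨φ⟩⟩ := h
  constructor
  · rintro ⟨c⟩
    by_contra hodd
    have hle : (SimpleGraph.cycleGraph l).chromaticNumber ≤ 2 :=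
      SimpleGraph.Colorable.chromaticNumber_le
        (SimpleGraph.Coloring.colorable (c.comp φ.symm.toHom))
    rw [SimpleGraph.chromaticNumber_cycleGraph_of_odd l (by omega) (Nat.not_even_iff_odd.1 hodd)]
      at hle
    exact absurd hle (by decide)
  · exact fun heven => ⟨(SimpleGraph.cycleGraph.bicoloring_of_even l heven).comp φ.toHom⟩

lemma IsDisjointUnionOfCycles.finrank_signSpace_one [Finite V] (h : IsDisjointUnionOfCycles H) :
    Module.finrank K (signSpace H (1 : K)) = numCycles H := by
  rw [finrank_signSpace, signComponents_one, numCycles]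
  congr 1
  exact (Set.eq_univ_of_forall h).symm

lemma IsDisjointUnionOfCycles.finrank_signSpace_neg_one [LinearOrder K] [IsStrictOrderedRing K]
    [Finite V] (h : IsDisjointUnionOfCycles H) :
    Module.finrank K (signSpace H (-1 : K)) = numEvenCycles H := by
  rw [finrank_signSpace, numEvenCycles]
  congr 1
  ext C
  rw [mem_signComponents_neg_one]
  constructor
  · obtain ⟨l, hl⟩ := h C
    exact fun hC => ⟨l, hl.nonempty_coloring_bool_iff.1 hC, hl⟩
  · rintro ⟨l, heven, hl⟩
    exact hl.nonempty_coloring_bool_iff.2 heven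

end Cycles

end SignSpace

section RegularSignSpace

variable {V : Type*} [Fintype V] {H : SimpleGraph V} [DecidableRel H.Adj] {r : ℕ}
  {K : Type*} [Field K] {t t' : K} {f g : V → K}

lemma adjMatrix_mulVec_of_mem_signSpace (hr : H.IsRegularOfDegree r)
    (hf : f ∈ signSpace H t) : H.adjMatrix K *ᵥ f = (r * t) • f := by
  funext x
  have hy : ∀ y ∈ H.neighborFinset x, f y = t * f x := fun y hy =>
    hf y x ((H.mem_neighborFinset x y).1 hy).symm
  rw [SimpleGraph.adjMatrix_mulVec_apply, sum_congr rfl hy, sum_const,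
    H.card_neighborFinset_eq_degree, hr x, nsmul_eq_mul, Pi.smul_apply, smul_eq_mul, mul_assoc]

lemma sum_sum_neighborFinset (hr : H.IsRegularOfDegree r) (g : V → K) :
    ∑ x, ∑ y ∈ H.neighborFinset x, g y = r * ∑ x, g x := by
  rw [sum_comm' (t' := univ) (s' := fun y => H.neighborFinset y)
    (by simp [SimpleGraph.adj_comm]), mul_sum]
  refine sum_congr rfl fun y _ => ?_
  rw [sum_const, H.card_neighborFinset_eq_degree, hr y, nsmul_eq_mul]

lemma sum_sum_sub_mul_sq (hr : H.IsRegularOfDegree r) (ht : t * t = 1) (f : V → K) :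
    ∑ x, ∑ y ∈ H.neighborFinset x, (f x - t * f y) ^ 2 =
      2 * t * (f ⬝ᵥ ((r * t) • f - H.adjMatrix K *ᵥ f)) := by
  have hx (x : V) : ∑ y ∈ H.neighborFinset x, (f x - t * f y) ^ 2 =
      r * f x ^ 2 - 2 * t * (f x * (H.adjMatrix K *ᵥ f) x) +
        ∑ y ∈ H.neighborFinset x, f y ^ 2 := by
    have hsq (y : V) : (f x - t * f y) ^ 2 = f x ^ 2 - 2 * t * (f x * f y) + f y ^ 2 := by
      linear_combination f y ^ 2 * ht
    simp only [hsq, sum_add_distrib, sum_sub_distrib, sum_const, H.card_neighborFinset_eq_degree,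
      hr x, nsmul_eq_mul, SimpleGraph.adjMatrix_mulVec_apply, ← mul_sum]
  have hdot : f ⬝ᵥ f = ∑ x, f x ^ 2 := sum_congr rfl fun x _ => (sq (f x)).symm
  simp only [hx, sum_add_distrib, sum_sub_distrib, ← mul_sum, sum_sum_neighborFinset hr]
  rw [dotProduct_sub, dotProduct_smul, smul_eq_mul, hdot, dotProduct]
  linear_combination (-2 * r * ∑ x, f x ^ 2) * ht

lemma mem_signSpace_iff_adjMatrix_mulVec [LinearOrder K] [IsStrictOrderedRing K]
    (hr : H.IsRegularOfDegree r) (ht : t * t = 1) :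
    f ∈ signSpace H t ↔ H.adjMatrix K *ᵥ f = (r * t) • f := by
  refine ⟨adjMatrix_mulVec_of_mem_signSpace hr, fun hf x y hxy => ?_⟩
  have hsum := sum_sum_sub_mul_sq hr ht f
  rw [hf, sub_self, dotProduct_zero, mul_zero,
    sum_eq_zero_iff_of_nonneg fun x _ => sum_nonneg fun y _ => sq_nonneg _] at hsum
  have hsq := (sum_eq_zero_iff_of_nonneg fun y _ => sq_nonneg _).1 (hsum x (mem_univ x)) y
    ((H.mem_neighborFinset x y).2 hxy)
  exact sub_eq_zero.1 (pow_eq_zero_iff two_ne_zero |>.1 hsq)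

lemma dotProduct_adjMatrix_mulVec (hr : H.IsRegularOfDegree r) (hf : f ∈ signSpace H t)
    (g : V → K) : f ⬝ᵥ H.adjMatrix K *ᵥ g = r * t * (f ⬝ᵥ g) := by
  rw [dotProduct_mulVec, ← mulVec_transpose, H.transpose_adjMatrix,
    adjMatrix_mulVec_of_mem_signSpace hr hf, smul_dotProduct, smul_eq_mul]

lemma dotProduct_eq_zero_of_mem_signSpace (hr : H.IsRegularOfDegree r) (hr₀ : (r : K) ≠ 0)
    (hf : f ∈ signSpace H t) (hg : g ∈ signSpace H t') (hne : t ≠ t') : f ⬝ᵥ g = 0 := by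
  have h := dotProduct_adjMatrix_mulVec hr hf g
  rw [adjMatrix_mulVec_of_mem_signSpace hr hg, dotProduct_smul, smul_eq_mul] at h
  exact (mul_eq_mul_right_iff.1 h).resolve_left fun h => hne (mul_left_cancel₀ hr₀ h).symm

end RegularSignSpace

section ExcessMatrix

variable {V : Type*} {G : SimpleGraph V} {n q r : ℕ} {K : Type*} [Field K]

lemma excessGraph_adj {d : ℕ} {x y : V} : (excessGraph G d).Adj x y ↔ G.dist x y = d + 1 := Iff.rfl

noncomputable instance (d : ℕ) : DecidableRel (excessGraph G d).Adj := fun _ _ =>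
  decidable_of_iff' _ excessGraph_adj

lemma colorSign_mul_colorSign (hc : G.Connected) (c : G.Coloring Bool) (x y : V) :
    colorSign K c x * colorSign K c y = (-1) ^ G.dist x y := by
  obtain ⟨p, hp⟩ := (hc x y).exists_walk_length_eq_dist
  rw [eq_pow_mul_of_mem_signSpace (colorSign_mem_signSpace c) p, hp, mul_assoc,
    colorSign_mul_self, mul_one]

lemma two_smul_adjMatrix_excessGraph_add_parityBallMatrix (hc : G.Connected)
    (c : G.Coloring Bool) (hdist : ∀ x y, G.dist x y ≤ n + 2) :
    (2 : K) • ((excessGraph G (n + 1)).adjMatrix K + parityBallMatrix G K n) =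
      vecMulVec 1 1 + (-1 : K) ^ n • vecMulVec (colorSign K c) (colorSign K c) := by
  ext x y
  have hle := hdist x y
  simp only [Matrix.smul_apply, Matrix.add_apply, SimpleGraph.adjMatrix_apply, excessGraph_adj,
    parityBallMatrix_apply, vecMulVec_apply, colorSign_mul_colorSign hc, Pi.one_apply, mul_one,
    smul_eq_mul, ← pow_add]
  by_cases heven : Even (n + G.dist x y)
  · rw [heven.neg_one_pow, one_add_one_eq_two]
    by_cases h : G.dist x y = n + 2
    · simp [h]
    · rw [if_neg h, if_pos ⟨by grind, heven⟩, zero_add, mul_one]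
  · rw [(Nat.not_even_iff_odd.1 heven).neg_one_pow, if_neg (by grind), if_neg (by grind)]
    simp

variable [Fintype V]

lemma two_smul_adjMatrix_excessGraph_mulVec (hc : G.Connected) (c : G.Coloring Bool)
    (hdist : ∀ x y, G.dist x y ≤ n + 2) (f : V → K) :
    (2 : K) • ((excessGraph G (n + 1)).adjMatrix K *ᵥ f + parityBallMatrix G K n *ᵥ f) =
      (1 ⬝ᵥ f) • 1 + ((-1) ^ n * (colorSign K c ⬝ᵥ f)) • colorSign K c := by
  rw [← add_mulVec, ← smul_mulVec,
    two_smul_adjMatrix_excessGraph_add_parityBallMatrix hc c hdist, add_mulVec, smul_mulVec,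
    vecMulVec_mulVec, vecMulVec_mulVec, op_smul_eq_smul, op_smul_eq_smul, smul_smul]

lemma adjMatrix_excessGraph_mulVec [CharZero K] (hc : G.Connected) (c : G.Coloring Bool)
    (hdist : ∀ x y, G.dist x y ≤ n + 2) {f : V → K} (h₁ : 1 ⬝ᵥ f = 0)
    (hs : colorSign K c ⬝ᵥ f = 0) :
    (excessGraph G (n + 1)).adjMatrix K *ᵥ f = -(parityBallMatrix G K n *ᵥ f) := by
  have h := two_smul_adjMatrix_excessGraph_mulVec hc c hdist f
  rw [h₁, hs, mul_zero, zero_smul, zero_smul, add_zero, smul_eq_zero_iff_right two_ne_zero] at h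
  exact eq_neg_of_add_eq_zero_left h

variable [DecidableRel G.Adj]

lemma one_dotProduct_colorSign [CharZero K] (hr : G.IsRegularOfDegree (q + 1))
    (c : G.Coloring Bool) : 1 ⬝ᵥ colorSign K c = 0 :=
  dotProduct_eq_zero_of_mem_signSpace hr (Nat.cast_ne_zero.2 q.succ_ne_zero)
    one_mem_signSpace_one (colorSign_mem_signSpace c) (by norm_num)

lemma aeval_mulVec_of_mulVec_eq_smul [DecidableEq V] {A : Matrix V V K} {f : V → K} {μ : K}
    (hf : A *ᵥ f = μ • f) (p : K[X]) : aeval A p *ᵥ f = p.eval μ • f := by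
  rw [← toLin'_apply, toLin'_aeval]
  exact Module.End.aeval_apply_of_mem_apply_eq_smul hf

lemma parityBallMatrix_mulVec_one (hr : G.IsRegularOfDegree (q + 1))
    (hg : ((2 * (n + 1) : ℕ) : ℕ∞) ≤ G.egirth) (hc : G.Connected) :
    parityBallMatrix G K n *ᵥ 1 = (∑ i ∈ range (n + 1), (q : K) ^ i) • 1 := by
  classical
  have h := adjMatrix_mulVec_of_mem_signSpace (K := K) hr one_mem_signSpace_one
  rw [mul_one, Nat.cast_add_one] at h
  rw [← aeval_adjMatrix_dickson_two hr hg hc n.lt_succ_self, aeval_mulVec_of_mulVec_eq_smul h,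
    eval_add_one_dickson_two]

theorem isRegularOfDegree_excessGraph (hr : G.IsRegularOfDegree (q + 1))
    (hg : ((2 * (n + 1) : ℕ) : ℕ∞) ≤ G.egirth) (hc : G.Connected) (c : G.Coloring Bool)
    (hdist : ∀ x y, G.dist x y ≤ n + 2)
    (hn : Fintype.card V = 2 * ∑ i ∈ range (n + 1), q ^ i + 2 * r) :
    (excessGraph G (n + 1)).IsRegularOfDegree r := by
  intro x
  have h := congrFun (two_smul_adjMatrix_excessGraph_mulVec (K := ℚ) hc c hdist 1) x
  have hdeg : ((excessGraph G (n + 1)).adjMatrix ℚ *ᵥ 1) x = (excessGraph G (n + 1)).degree x :=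
    ((excessGraph G (n + 1)).adjMatrix_mulVec_const_apply (a := 1)).trans (mul_one _)
  rw [parityBallMatrix_mulVec_one hr hg hc, dotProduct_comm (colorSign ℚ c),
    one_dotProduct_colorSign hr, mul_zero, zero_smul, add_zero, one_dotProduct_one, hn] at h
  simp only [Pi.smul_apply, Pi.add_apply, hdeg, Pi.one_apply, smul_eq_mul, mul_one] at h
  push_cast at h
  exact_mod_cast (show ((excessGraph G (n + 1)).degree x : ℚ) = r by linarith)

end ExcessMatrix

section Divisibility

variable {V : Type*} [Fintype V] {H : SimpleGraph V} [DecidableRel H.Adj] {r : ℕ}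

lemma finrank_inf_ker_dotProductBilin {K : Type*} [Field K] [LinearOrder K]
    [IsStrictOrderedRing K] (hr : H.IsRegularOfDegree r) (hr₀ : r ≠ 0) {t t' : K}
    {W : Submodule K (V → K)} {w : V → K} (hW : W ≤ signSpace H t) (hw : w ∈ signSpace H t')
    (hw₀ : w ≠ 0) (hwW : t = t' → w ∈ W) :
    Module.finrank K (W ⊓ (dotProductBilin K K w).ker : Submodule K (V → K)) +
      (if t = t' then 1 else 0) = Module.finrank K W := by
  split_ifs with h
  · exact finrank_inf_ker_add_one (hwW h) (dotProduct_self_eq_zero.not.2 hw₀)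
  · rw [inf_eq_left.2 fun f hf => dotProduct_eq_zero_of_mem_signSpace hr (Nat.cast_ne_zero.2 hr₀)
      hw (hW hf) (Ne.symm h), add_zero]

variable {G : SimpleGraph V} [DecidableRel G.Adj] {n q p : ℕ}

lemma mem_signSpace_excessGraph_iff [DecidableEq V] {K : Type*} [Field K] [LinearOrder K]
    [IsStrictOrderedRing K] (hr : G.IsRegularOfDegree (q + 1))
    (hg : ((2 * (n + 1) : ℕ) : ℕ∞) ≤ G.egirth) (hc : G.Connected) (c : G.Coloring Bool)
    (hdist : ∀ x y, G.dist x y ≤ n + 2) (hE : (excessGraph G (n + 1)).IsRegularOfDegree r)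
    {t : K} (ht : t * t = 1) {f : V → K} (h₁ : 1 ⬝ᵥ f = 0) (hs : colorSign K c ⬝ᵥ f = 0) :
    f ∈ signSpace (excessGraph G (n + 1)) t ↔
      aeval (toLin' (G.adjMatrix K)) (dickson 2 (q : K) n + C (r * t)) f = 0 := by
  rw [mem_signSpace_iff_adjMatrix_mulVec hE ht, adjMatrix_excessGraph_mulVec hc c hdist h₁ hs,
    ← toLin'_aeval, toLin'_apply, map_add, aeval_C, Algebra.algebraMap_eq_smul_one,
    add_mulVec, smul_mulVec, one_mulVec,
    aeval_adjMatrix_dickson_two hr hg hc n.lt_succ_self, neg_eq_iff_add_eq_zero]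

lemma irreducible_dickson_two_add_C_mul (hp : p.Prime) (hpq : p ∣ q) (hpr : p ∣ r)
    (hpr' : ¬ p ^ 2 ∣ r) (hn : 3 ≤ n) {t : ℤ} (ht : t * t = 1) :
    Irreducible (dickson 2 (q : ℚ) n + C ((r : ℚ) * t)) := by
  have h := irreducible_dickson_two_add_C ℚ (P := Ideal.span {(p : ℤ)}) (a := (q : ℤ))
    (c := (r : ℤ) * t)
    ((Ideal.span_singleton_prime (by exact_mod_cast hp.ne_zero)).2
      (Nat.prime_iff_prime_int.1 hp))
    (Ideal.mem_span_singleton.2 (by exact_mod_cast hpq))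
    (Ideal.mem_span_singleton.2 ((Int.natCast_dvd_natCast.2 hpr).mul_right t)) (fun h => hpr' ?_) hn
  · simpa using h
  · rw [Ideal.span_singleton_pow, Ideal.mem_span_singleton] at h
    have h' := h.mul_right t
    rw [mul_assoc, ht, mul_one] at h'
    exact_mod_cast h'

lemma dvd_finrank_signSpace_excessGraph_inf (hr : G.IsRegularOfDegree (q + 1))
    (hg : ((2 * (n + 1) : ℕ) : ℕ∞) ≤ G.egirth) (hc : G.Connected) (c : G.Coloring Bool)
    (hdist : ∀ x y, G.dist x y ≤ n + 2) (hE : (excessGraph G (n + 1)).IsRegularOfDegree r)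
    (hp : p.Prime) (hpq : p ∣ q) (hpr : p ∣ r) (hpr' : ¬ p ^ 2 ∣ r) (hn : 3 ≤ n) {t : ℤ}
    (ht : t * t = 1) :
    n ∣ Module.finrank ℚ (signSpace (excessGraph G (n + 1)) (t : ℚ) ⊓
      (dotProductBilin ℚ ℚ 1).ker ⊓ (dotProductBilin ℚ ℚ (colorSign ℚ c)).ker :
        Submodule ℚ (V → ℚ)) := by
  classical
  have ht' : (t : ℚ) * t = 1 := mod_cast ht
  set P := dickson 2 (q : ℚ) n + C ((r : ℚ) * t)
  set U := (dotProductBilin ℚ ℚ (1 : V → ℚ)).ker ⊓ (dotProductBilin ℚ ℚ (colorSign ℚ c)).ker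
  have hU : ∀ f ∈ U, toLin' (G.adjMatrix ℚ) f ∈ U := by
    rintro f ⟨h₁ : 1 ⬝ᵥ f = 0, hs : colorSign ℚ c ⬝ᵥ f = 0⟩
    refine ⟨?_, ?_⟩
    · change 1 ⬝ᵥ G.adjMatrix ℚ *ᵥ f = 0
      rw [dotProduct_adjMatrix_mulVec hr one_mem_signSpace_one, h₁, mul_zero]
    · change colorSign ℚ c ⬝ᵥ G.adjMatrix ℚ *ᵥ f = 0
      rw [dotProduct_adjMatrix_mulVec hr (colorSign_mem_signSpace c), hs, mul_zero]
  have hker : signSpace (excessGraph G (n + 1)) (t : ℚ) ⊓ U =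
      U ⊓ (aeval (toLin' (G.adjMatrix ℚ)) P).ker := by
    rw [inf_comm]
    ext f
    exact and_congr_right fun hf => mem_signSpace_excessGraph_iff hr hg hc c hdist hE ht' hf.1 hf.2
  have hdeg : P.natDegree = n :=
    ((isMonicOfDegree_dickson_two (q : ℚ) n).add_right (by rw [natDegree_C]; omega)).natDegree_eq
  rw [inf_assoc, hker, ← hdeg]
  exact natDegree_dvd_finrank_inf_ker_aeval
    (irreducible_dickson_two_add_C_mul hp hpq hpr hpr' hn ht) hU

theorem dvd_finrank_signSpace_excessGraph_sub (hr : G.IsRegularOfDegree (q + 1))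
    (hg : ((2 * (n + 1) : ℕ) : ℕ∞) ≤ G.egirth) (hc : G.Connected) (c : G.Coloring Bool)
    (hdist : ∀ x y, G.dist x y ≤ n + 2) (hE : (excessGraph G (n + 1)).IsRegularOfDegree r)
    (hp : p.Prime) (hpq : p ∣ q) (hpr : p ∣ r) (hpr' : ¬ p ^ 2 ∣ r) (hn : 3 ≤ n) {t : ℤ}
    (ht : t * t = 1) :
    (n : ℤ) ∣ Module.finrank ℚ (signSpace (excessGraph G (n + 1)) (t : ℚ)) -
      ((if t = 1 then 1 else 0) + if t = (-1) ^ n then 1 else 0) := by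
  have := hc.nonempty
  have hr₀ : r ≠ 0 := by
    rintro rfl
    exact hpr' (dvd_zero _)
  have hs₀ : colorSign ℚ c ≠ 0 := fun h => by
    simpa [h] using colorSign_mul_self (K := ℚ) c (Classical.arbitrary V)
  have hs : colorSign ℚ c ∈ signSpace (excessGraph G (n + 1)) ((-1) ^ n) := by
    simpa only [pow_add, neg_one_sq, mul_one, add_assoc, one_add_one_eq_two] using
      signSpace_le_signSpace_excessGraph G (n + 1) _ (colorSign_mem_signSpace (K := ℚ) c)
  have hone := finrank_inf_ker_dotProductBilin hE hr₀ (t := (t : ℚ)) le_rfl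
    one_mem_signSpace_one one_ne_zero fun h => h ▸ one_mem_signSpace_one
  have hsign := finrank_inf_ker_dotProductBilin hE hr₀ (t := (t : ℚ))
    (W := signSpace (excessGraph G (n + 1)) (t : ℚ) ⊓ (dotProductBilin ℚ ℚ 1).ker)
    inf_le_left hs hs₀ fun h => ⟨h ▸ hs, one_dotProduct_colorSign hr c⟩
  have hdvd := dvd_finrank_signSpace_excessGraph_inf hr hg hc c hdist hE hp hpq hpr hpr' hn ht
  have ht₁ : (t : ℚ) = 1 ↔ t = 1 := Int.cast_eq_one
  have htn : (t : ℚ) = (-1) ^ n ↔ t = (-1) ^ n := mod_cast Iff.rfl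
  rw [← hone, ← hsign]
  simp only [ht₁, htn]
  push_cast
  rw [add_assoc, add_comm (ite (t = 1) _ _), add_sub_cancel_right]
  exact Int.natCast_dvd_natCast.2 hdvd

end Divisibility

section Excess

lemma card_eq_of_excess_eq {V : Type*} [Fintype V] {q d e : ℕ}
    (h : excess V (q + 1) (2 * d) = e) :
    Fintype.card V = 2 * ∑ i ∈ range d, q ^ i + e := by
  rw [excess, mooreBound, if_neg (by simp), Nat.mul_div_cancel_left d two_pos, Nat.cast_add_one,
    add_sub_cancel_right, sub_eq_iff_eq_add'] at h
  exact_mod_cast h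

end Excess

end CageExcess

theorem mainTheorem4 {V : Type*} [Fintype V] (G : SimpleGraph V) [DecidableRel G.Adj]
    (k d : ℕ) (hk : 7 ≤ k) (hk_odd : Odd k) (hd : 8 ≤ 2 * d)
    (hG : CageExcess.IsKGGraph G k (2 * d))
    (hexcess : CageExcess.excess V k (2 * d) = 4) :
    CageExcess.IsDisjointUnionOfCycles (CageExcess.excessGraph G d) ∧
    (Odd d →
      (d : ℤ) - 1 ∣ (CageExcess.numCycles (CageExcess.excessGraph G d) : ℤ) - 2 ∧
      (d : ℤ) - 1 ∣ (CageExcess.numEvenCycles (CageExcess.excessGraph G d) : ℤ)) ∧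
    (Even d →
      (d : ℤ) - 1 ∣ (CageExcess.numCycles (CageExcess.excessGraph G d) : ℤ) - 1 ∧
      (d : ℤ) - 1 ∣ (CageExcess.numEvenCycles (CageExcess.excessGraph G d) : ℤ) - 1) := by
  open CageExcess in
  obtain ⟨m, rfl⟩ := hk_odd
  obtain ⟨n, rfl⟩ : ∃ n, d = n + 1 := ⟨d - 1, by omega⟩
  have hr := hG.regular
  have hg : ((2 * (n + 1) : ℕ) : ℕ∞) ≤ G.egirth := hG.girth_eq ▸ ENat.natCast_toNat_le_self _
  have hn := card_eq_of_excess_eq (e := 4) hexcess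
  have : Nonempty V := Fintype.card_pos_iff.1 (by omega)
  have hc : G.Connected := connected_of_card_le hr hg hn.le (by omega)
  have hdist : ∀ x y, G.dist x y ≤ n + 2 := dist_le_add_one hr hg hn.le (by omega)
  obtain ⟨c⟩ := nonempty_coloring_bool hr hg hn.le (by omega) (by omega) hc
  have hE := isRegularOfDegree_excessGraph (r := 2) hr hg hc c hdist hn
  have hcycles := isDisjointUnionOfCycles hE
  have hdvd {t : ℤ} := dvd_finrank_signSpace_excessGraph_sub (t := t) hr hg hc c hdist hE
    Nat.prime_two (dvd_mul_right 2 m) dvd_rfl (by norm_num) (by omega)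
  have h₁ := hdvd (t := 1) rfl
  have h₂ := hdvd (t := -1) rfl
  rw [Int.cast_one, hcycles.finrank_signSpace_one] at h₁
  rw [Int.cast_neg, Int.cast_one, hcycles.finrank_signSpace_neg_one] at h₂
  rw [Nat.cast_add_one, add_sub_cancel_right]
  refine ⟨hcycles, fun hodd => ?_, fun heven => ?_⟩
  · rw [(show Even n by grind).neg_one_pow] at h₁ h₂
    exact ⟨by simpa using h₁, by simpa using h₂⟩
  · rw [(show Odd n by grind).neg_one_pow] at h₁ h₂
    exact ⟨by simpa using h₁, by simpa using h₂⟩
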